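/- Let $1\le m\le n$, let $K_{m,n}$ be the complete bipartite graph with parts $V_1,V_2$, $|V_1|=m$, $|V_2|=n$, and let $\mathcal N$ be the set of its perfect matchings (the maximal matchings; they have $m$ edges). Let $U:\mathcal N\to\mathbb R$ be a utility function with maximum $U_{\max}$ and minimum $U_{\min}$, and let $\beta\ge 0$. The Markov chain $\mathcal M=\mathcal M(\beta,U)$ on $\mathcal N$ moves as follows. In state $M$, with $y\in V_1$ and $z\in V_2$ chosen uniformly at random and $z_1$ the partner of $y$ in $M$, let $\tilde M=M$ if $z=z_1$; let $\tilde M$ be $M$ with $(y,z_1)$ replaced by $(y,z)$ if $z$ is unmatched in $M$; and let $\tilde M$ be $M$ with $(y,z_1),(y_1,z)$ replaced by $(y,z),(y_1,z_1)$ if $z$ is the partner of some $y_1\ne y$. The chain moves to $\tilde M$ with probability $a_{M\tilde M}=\min\{1,e^{\beta(U(\tilde M)-U(M))}\}$ and stays at $M$ otherwise. The lazy version of $\mathcal M$ moves from $M$ to $M'$ with probability $a_{MM'}/(2mn)$ for every $M'\neq M$ that is a possible $\tilde M$ from $M$, and stays with the remaining probability. Let $\pi_M=e^{\beta U(M)}/\sum_{M'\in\mathcal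 N}e^{\beta U(M')}$. For a chain with transition matrix $P$ put $d(t)=\frac12\max_{M'}\sum_{M}|P^{t}_{M'M}-\pi_M|$ and $\tau_\epsilon=\min\{t: d(t)\le\epsilon\}$ for $\epsilon>0$. For a fixed $\beta\ge 0$ and a family of instances $(m_i,n_i,U_i)_{i\in I}$ with $1\le m_i\le n_i$, say that the chains are *rapidly mixing* if, for each $i$, $\pi$ is a stationary distribution of the $i$-th chain, and there are constants $C,k$ such that for all $i\in I$ and all $\epsilon>0$ the mixing time exists and $\tau_\epsilon\le C\,n_i^{k}\,(1+\max\{0,\ln(1/\epsilon)\})$. **Theorem.** Fix $\beta\ge0$ and a family of instances $(m_i,n_i,U_i)_{i\in I}$ with $1\le m_i\le n_i$. (1) If $U_{\max}-U_{\min}$ is bounded or grows at most logarithmically with the input size, i.e. there are constants $A,B$ with $U_{i,\max}-U_{i,\min}\le A+B\ln n_i$ for all $i$, then the chains $\mathcal M(\beta,U_i)$ are rapidly mixing, and so are their lazy versions. (2) Suppose that $U_{\max}-U_{\min}$ grows at most polynomially, and that the utilities, after adding constants $s_i\in\mathbb R$, are positive and not smaller than an inverse polynomial: there are constants $C>0$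 and $k\in\mathbb N$ with $U_{i,\max}-U_{i,\min}\le C n_i^{k}$ and $U_i(M)+s_i\ge 1/(C n_i^{k})$ for all $i$ and $M$. (One may take $s_i=0$ if the $U_i$ are bounded below by a positive constant. The choice $s_i=1-U_{i,\min}$ is always possible, after enlarging $C$ if necessary.) Then $\ln(U_i+s_i)$ has the same maximizing matchings as $U_i$, its range (maximum minus minimum) is at most $A+B\ln n_i$ for some constants $A,B$, and the chains $\mathcal M(\beta,\ln(U_i+s_i))$ and their lazy versions are rapidly mixing. -/

import Mathlib

/-- A set `E` of edges of the complete bipartite graph on `Fin m` and `Fin n` is a matching if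
distinct edges share no endpoint on either side. -/
def IsBipartiteMatching {m n : ℕ} (E : Finset (Fin m × Fin n)) : Prop :=
  ∀ e ∈ E, ∀ f ∈ E, e ≠ f → e.1 ≠ f.1 ∧ e.2 ≠ f.2

/-- A perfect matching is a matching to which no edge can be added. -/
def IsPerfectBipartiteMatching {m n : ℕ} (E : Finset (Fin m × Fin n)) : Prop :=
  IsBipartiteMatching E ∧ ∀ e, e ∉ E → ¬ IsBipartiteMatching (insert e E)

/-- The state space: perfect matchings of the complete bipartite graph with parts `Fin m` and
`Fin n`. For `m ≤ n` these are the injections sending each left node to its partner;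
see `isPerfectBipartiteMatching_iff`. -/
abbrev PerfectMatching (m n : ℕ) : Type := Fin m ↪ Fin n

/-- The edge set of a perfect matching. -/
def PerfectMatching.edges {m n : ℕ} (M : PerfectMatching m n) : Finset (Fin m × Fin n) :=
  Finset.univ.image fun y => (y, M y)

/-- For `m ≤ n`, the edge sets that are perfect matchings are exactly those of injections. -/
theorem isPerfectBipartiteMatching_iff {m n : ℕ} (hmn : m ≤ n) (E : Finset (Fin m × Fin n)) :
    IsPerfectBipartiteMatching E ↔ ∃ M : PerfectMatching m n, E = M.edges := by
  constructor
  · rintro ⟨hE, hmax⟩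
    have hinj : Set.InjOn Prod.fst (E : Set (Fin m × Fin n)) := by
      intro e he f hf h
      by_contra hne
      exact (hE e he f hf hne).1 h
    have hinj2 : Set.InjOn Prod.snd (E : Set (Fin m × Fin n)) := by
      intro e he f hf h
      by_contra hne
      exact (hE e he f hf hne).2 h
    have hcov : ∀ y : Fin m, ∃ z, (y, z) ∈ E := by
      intro y
      by_contra! hy
      have h1 : (E.image Prod.fst).card < m := by
        have : E.image Prod.fst ⊂ Finset.univ := by
          refine Finset.ssubset_univ_iff.2 fun h => ?_
          have := h ▸ Finset.mem_univ y
          obtain ⟨⟨a, b⟩, hab, rfl⟩ := Finset.mem_image.1 this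
          exact hy b hab
        simpa using Finset.card_lt_card this
      rw [Finset.card_image_of_injOn hinj] at h1
      have h2 : (E.image Prod.snd).card < n := by
        rw [Finset.card_image_of_injOn hinj2]; omega
      obtain ⟨z, hz⟩ : ∃ z, z ∉ E.image Prod.snd := by
        by_contra! h
        have : E.image Prod.snd = Finset.univ := Finset.eq_univ_iff_forall.2 h
        rw [this] at h2
        simp at h2
      have hz' : ∀ a, (a, z) ∉ E := fun a ha => hz (Finset.mem_image.2 ⟨_, ha, rfl⟩)
      refine hmax (y, z) (hy z) ?_
      rintro ⟨a, b⟩ he ⟨c, d⟩ hf hne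
      rw [Finset.mem_insert] at he hf
      rcases he with he | he <;> rcases hf with hf | hf
      · exact absurd (he.trans hf.symm) hne
      · cases he
        exact ⟨fun h => hy d (by rw [show y = c from h]; exact hf),
          fun h => hz' c (by rw [show z = d from h]; exact hf)⟩
      · cases hf
        exact ⟨fun h => hy b (by rw [← show a = y from h]; exact he),
          fun h => hz' a (by rw [← show b = z from h]; exact he)⟩
      · exact hE _ he _ hf hne
    choose M hM using hcov
    refine ⟨⟨M, fun a b h => ?_⟩, ?_⟩
    · exact congrArg Prod.fst (hinj2 (hM a) (hM b) h)
    · ext ⟨a, b⟩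
      simp only [PerfectMatching.edges, Finset.mem_image, Finset.mem_univ, true_and]
      constructor
      · intro h
        exact ⟨a, hinj (hM a) h rfl⟩
      · rintro ⟨y, hy⟩
        exact hy ▸ hM y
  · rintro ⟨M, rfl⟩
    have hmem : ∀ e : Fin m × Fin n, e ∈ M.edges ↔ M e.1 = e.2 := by
      rintro ⟨a, b⟩
      simp [PerfectMatching.edges]
    refine ⟨fun e he f hf hne => ?_, fun e he h => ?_⟩
    · rw [hmem] at he hf
      refine ⟨fun h => hne (Prod.ext h ?_), fun h => hne (Prod.ext (M.injective ?_) h)⟩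
      · rw [← he, ← hf, h]
      · rw [he, hf, h]
    · have h1 : (e.1, M e.1) ∈ M.edges := (hmem _).2 rfl
      refine (h e (Finset.mem_insert_self _ _) _ (Finset.mem_insert_of_mem h1) ?_).1 rfl
      intro h2
      exact he (h2 ▸ h1)

noncomputable section

/-- The matching proposed from `M` when the nodes `y`, `z` are selected: the roles of `z` and of the
partner `M y` of `y` are exchanged. So nothing changes if `z = M y`; if `z` is unmatched, then `y` is
rematched to `z`; if `z` is the partner of `y₁ ≠ y`, then `y` gets `z` and `y₁` gets `M y`. -/
def proposal {m n : ℕ} (M : PerfectMatching m n) (y : Fin m) (z : Fin n) : PerfectMatching m n :=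
  M.trans (Equiv.swap (M y) z).toEmbedding

/-- The probability of accepting the proposal `M'` in state `M`. -/
def acceptProb {m n : ℕ} (β : ℝ) (U : PerfectMatching m n → ℝ) (M M' : PerfectMatching m n) : ℝ :=
  min 1 (Real.exp (β * (U M' - U M)))

/-- The transition matrix of the algorithm: select `(y, z)` uniformly at random, move to the proposal
with the acceptance probability, and stay otherwise. -/
def transitionMatrix {m n : ℕ} (β : ℝ) (U : PerfectMatching m n → ℝ) :
    Matrix (PerfectMatching m n) (PerfectMatching m n) ℝ :=
  fun M M' => ∑ y : Fin m, ∑ z : Fin n, 1 / ((m : ℝ) * n) *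
    ((if M' = proposal M y z then acceptProb β U M (proposal M y z) else 0) +
      (if M' = M then 1 - acceptProb β U M (proposal M y z) else 0))

/-- Distinct matchings one of which is a proposal from the other. -/
def IsAdjacentMatching {m n : ℕ} (M M' : PerfectMatching m n) : Prop :=
  M ≠ M' ∧ ∃ y z, M' = proposal M y z

open Classical in
/-- Probability of the move from `M` to `M'` in the lazy version of the chain: it is
`acceptProb / (2mn)` if the matchings are adjacent, and zero otherwise. -/
def lazyMoveProb {m n : ℕ} (β : ℝ) (U : PerfectMatching m n → ℝ) (M M' : PerfectMatching m n) : ℝ :=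
  if IsAdjacentMatching M M' then 1 / (2 * (m : ℝ) * n) * acceptProb β U M M' else 0

/-- The transition matrix of the lazy version of the chain: moves have probability `lazyMoveProb`,
and the remaining probability is that of staying. -/
def lazyTransitionMatrix {m n : ℕ} (β : ℝ) (U : PerfectMatching m n → ℝ) :
    Matrix (PerfectMatching m n) (PerfectMatching m n) ℝ :=
  fun M M' => if M' = M then 1 - ∑ M'', lazyMoveProb β U M M'' else lazyMoveProb β U M M'

/-- The Gibbs distribution. -/
def gibbs {m n : ℕ} (β : ℝ) (U : PerfectMatching m n → ℝ) (M : PerfectMatching m n) : ℝ :=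
  Real.exp (β * U M) / ∑ M' : PerfectMatching m n, Real.exp (β * U M')

/-- `U_max - U_min`. -/
def utilityRange {m n : ℕ} (U : PerfectMatching m n → ℝ) : ℝ := (⨆ M, U M) - ⨅ M, U M

/-- `π` is a stationary distribution of the chain with transition matrix `P`. -/
def IsStationaryDistribution {Ω : Type*} [Fintype Ω] (P : Matrix Ω Ω ℝ) (π : Ω → ℝ) : Prop :=
  (∀ x, 0 ≤ π x) ∧ ∑ x, π x = 1 ∧ Matrix.vecMul π P = π

/-- The total variation distance `d(t)` to `π` after `t` steps, for the worst initial state. -/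
def tvDistance {Ω : Type*} [Fintype Ω] [DecidableEq Ω] (P : Matrix Ω Ω ℝ) (π : Ω → ℝ) (t : ℕ) : ℝ :=
  1 / 2 * ⨆ x, ∑ y, |(P ^ t) x y - π y|

/-- `τ = min {t | d(t) ≤ ε}`; in particular such `t` exist. -/
def IsMixingTime {Ω : Type*} [Fintype Ω] [DecidableEq Ω] (P : Matrix Ω Ω ℝ) (π : Ω → ℝ)
    (ε : ℝ) (τ : ℕ) : Prop :=
  IsLeast {t : ℕ | tvDistance P π t ≤ ε} τ

/-- A family of finite Markov chains with transition matrices `P i`, stationary distributions `π i`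
and input sizes `size i` is rapidly mixing: the `ε`-mixing times are bounded by a polynomial in the
input size times `1 + log⁺ (1 / ε)`. -/
def RapidlyMixing {ι : Type*} (size : ι → ℕ) (Ω : ι → Type*) [∀ i, Fintype (Ω i)]
    [∀ i, DecidableEq (Ω i)] (P : ∀ i, Matrix (Ω i) (Ω i) ℝ) (π : ∀ i, Ω i → ℝ) : Prop :=
  (∀ i, P i ∈ Matrix.rowStochastic ℝ (Ω i) ∧ IsStationaryDistribution (P i) (π i)) ∧
  ∃ (C : ℝ) (k : ℕ), ∀ i, ∀ ε : ℝ, 0 < ε → ∃ τ : ℕ, IsMixingTime (P i) (π i) ε τ ∧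
    (τ : ℝ) ≤ C * (size i : ℝ) ^ k * (1 + Real.posLog (1 / ε))

/-- Rapid mixing, for the inverse temperature `β` and the utility functions `U i` on the perfect
matchings of the complete bipartite graphs with parts of sizes `m i` and `n i`, of the chain run by
the algorithm and of its lazy version, both towards the Gibbs distribution. -/
def MatchingChainRapidlyMixing {ι : Type*} (β : ℝ) (m n : ι → ℕ)
    (U : ∀ i, PerfectMatching (m i) (n i) → ℝ) : Prop :=
  RapidlyMixing n (fun i => PerfectMatching (m i) (n i))
    (fun i => transitionMatrix β (U i)) (fun i => gibbs β (U i)) ∧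
  RapidlyMixing n (fun i => PerfectMatching (m i) (n i))
    (fun i => lazyTransitionMatrix β (U i)) (fun i => gibbs β (U i))

end

/-! Both chains are reversible for the Gibbs weights `π`, since `π M * acceptProb` is the symmetric
expression `min (π M) (π M')`. Rapid mixing follows from a polynomial spectral gap, obtained by
comparison with the uniform distribution.

Any two injections differ by a permutation of the values, which is a product of at most `n`
transpositions, and a transposition either fixes a matching or is a move of the chain. Averaging
over all permutations gives a Poincaré inequality for the uniform distribution
(`exists_sum_sub_const_sq_le`). If the utility has range at most `R`, Gibbs weights differ by at
most the factor `r = exp (β * R)`, so the inequality transfers with a loss of `r`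
(`IsMetropolisChain.sum_gibbs_mul_sq_le`).

Negative eigenvalues are controlled by the holding probabilities, at least `1 / (2 * n)` even
without laziness (`sum_weight_mul_mulVec_sq_le`). Hence one step contracts the variance by `1 - 1 /
(4 * r * n ^ 5)`. A range logarithmic in `n` makes `r` polynomial, and taking logarithms of
polynomially controlled utilities produces such a range (`utilityRange_log_le`). -/

/-! ### Reversible chains: variance contraction and mixing times -/

open Matrix in
/-- Detailed balance makes a transition matrix self-adjoint for the weighted inner product. -/
theorem sum_weight_mul_mulVec_comm {Ω : Type*} [Fintype Ω] {P : Matrix Ω Ω ℝ} {π : Ω → ℝ}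
    (hrev : ∀ x y, π x * P x y = π y * P y x) (f g : Ω → ℝ) :
    ∑ x, π x * f x * (P *ᵥ g) x = ∑ x, π x * (P *ᵥ f) x * g x := by
  simp only [mulVec, dotProduct, Finset.mul_sum, Finset.sum_mul]
  rw [Finset.sum_comm]
  refine Finset.sum_congr rfl fun y _ => Finset.sum_congr rfl fun x _ => ?_
  linear_combination f x * g y * hrev x y

/-- Detailed balance passes to powers. -/
theorem detailedBalance_pow {Ω : Type*} [Fintype Ω] [DecidableEq Ω] {P : Matrix Ω Ω ℝ}
    {π : Ω → ℝ} (hrev : ∀ x y, π x * P x y = π y * P y x) (t : ℕ) (x y : Ω) :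
    π x * (P ^ t) x y = π y * (P ^ t) y x := by
  induction t generalizing x y with
  | zero =>
    by_cases h : x = y
    · rw [h]
    · simp [h, Ne.symm h]
  | succ t ih =>
    rw [pow_succ, Matrix.mul_apply, ← pow_succ, pow_succ', Matrix.mul_apply]
    simp only [Finset.mul_sum]
    refine Finset.sum_congr rfl fun z _ => ?_
    linear_combination P z y * ih x z + (P ^ t) z x * hrev z y

/-- The Dirichlet form of a reversible stochastic matrix. -/
theorem sum_weight_mul_sub_sq {Ω : Type*} [Fintype Ω] [DecidableEq Ω] {Q : Matrix Ω Ω ℝ}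
    {π : Ω → ℝ} (hQ : Q ∈ Matrix.rowStochastic ℝ Ω)
    (hrev : ∀ x y, π x * Q x y = π y * Q y x) (f : Ω → ℝ) :
    ∑ x, ∑ y, π x * Q x y * (f x - f y) ^ 2 =
      2 * (∑ x, π x * f x ^ 2 - ∑ x, π x * f x * (Q.mulVec f) x) := by
  have hrow := Matrix.sum_row_of_mem_rowStochastic hQ
  have h1 : ∑ x, ∑ y, π x * Q x y * f x ^ 2 = ∑ x, π x * f x ^ 2 := by
    refine Finset.sum_congr rfl fun x _ => ?_
    rw [← Finset.sum_mul, ← Finset.mul_sum, hrow, mul_one]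
  have h2 : ∑ x, ∑ y, π x * Q x y * f y ^ 2 = ∑ x, π x * f x ^ 2 := by
    rw [Finset.sum_comm, ← h1]
    exact Finset.sum_congr rfl fun x _ => Finset.sum_congr rfl fun y _ => by rw [hrev]
  have h3 : ∑ x, ∑ y, π x * Q x y * (f x * f y) = ∑ x, π x * f x * (Q.mulVec f) x := by
    simp only [Matrix.mulVec, dotProduct, Finset.mul_sum]
    exact Finset.sum_congr rfl fun x _ => Finset.sum_congr rfl fun y _ => by ring
  calc ∑ x, ∑ y, π x * Q x y * (f x - f y) ^ 2
      = ∑ x, ∑ y, (π x * Q x y * f x ^ 2 + π x * Q x y * f y ^ 2 -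
          2 * (π x * Q x y * (f x * f y))) :=
        Finset.sum_congr rfl fun x _ => Finset.sum_congr rfl fun y _ => by ring
    _ = _ := by
        simp only [Finset.sum_sub_distrib, Finset.sum_add_distrib, ← Finset.mul_sum, h1, h2, h3]
        ring

/-- One step of a reversible chain with holding probabilities at least `δ` decreases the second
moment by at least `δ` times the Dirichlet sum. -/
theorem sum_weight_mul_mulVec_sq_le {Ω : Type*} [Fintype Ω] [DecidableEq Ω] {P : Matrix Ω Ω ℝ}
    {π : Ω → ℝ} (hπ : ∀ x, 0 ≤ π x) (hP : P ∈ Matrix.rowStochastic ℝ Ω)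
    (hrev : ∀ x y, π x * P x y = π y * P y x) {δ : ℝ} (hδ : ∀ x, δ ≤ P x x) (f : Ω → ℝ) :
    ∑ x, π x * (P.mulVec f) x ^ 2 ≤
      ∑ x, π x * f x ^ 2 - δ * ∑ x, ∑ y, π x * P x y * (f x - f y) ^ 2 := by
  have hnn : ∀ x y, 0 ≤ P x y := hP.1
  -- The Dirichlet sum of `P * P` is twice the second moment lost in one step of `P`, so it suffices
  -- to compare it with that of `P`.
  have h1 := sum_weight_mul_sub_sq (mul_mem hP hP)
    (fun x y => by simpa [sq] using detailedBalance_pow hrev 2 x y) f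
  have h2 : ∑ x, π x * f x * ((P * P).mulVec f) x = ∑ x, π x * (P.mulVec f) x ^ 2 := by
    rw [← Matrix.mulVec_mulVec, sum_weight_mul_mulVec_comm hrev]
    exact Finset.sum_congr rfl fun x _ => by ring
  have h3 : 2 * (δ * ∑ x, ∑ y, π x * P x y * (f x - f y) ^ 2) ≤
      ∑ x, ∑ y, π x * (P * P) x y * (f x - f y) ^ 2 := by
    simp only [Finset.mul_sum]
    refine Finset.sum_le_sum fun x _ => Finset.sum_le_sum fun y _ => ?_
    by_cases hxy : x = y
    · simp [hxy]
    -- Among the two-step paths, keep `x, x, y` and `x, y, y`: each is a move together with a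
    -- holding step.
    have h4 : 2 * δ * P x y ≤ (P * P) x y := by
      rw [Matrix.mul_apply]
      calc 2 * δ * P x y = δ * P x y + P x y * δ := by ring
        _ ≤ P x x * P x y + P x y * P y y :=
          add_le_add (mul_le_mul_of_nonneg_right (hδ x) (hnn x y))
            (mul_le_mul_of_nonneg_left (hδ y) (hnn x y))
        _ = ∑ z ∈ {x, y}, P x z * P z y := by rw [Finset.sum_pair hxy]
        _ ≤ _ := Finset.sum_le_sum_of_subset_of_nonneg (Finset.subset_univ _)
          fun z _ _ => mul_nonneg (hnn _ _) (hnn _ _)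
    calc 2 * (δ * (π x * P x y * (f x - f y) ^ 2))
        = 2 * δ * P x y * (π x * (f x - f y) ^ 2) := by ring
      _ ≤ (P * P) x y * (π x * (f x - f y) ^ 2) :=
        mul_le_mul_of_nonneg_right h4 (mul_nonneg (hπ x) (sq_nonneg _))
      _ = _ := by ring
  rw [h2] at h1
  linarith

/-- A reversible chain that contracts the variance by the factor `1 - γ` in each step converges
exponentially fast in total variation. -/
theorem sq_sum_abs_pow_sub_le {Ω : Type*} [Fintype Ω] [DecidableEq Ω] {P : Matrix Ω Ω ℝ}
    {π : Ω → ℝ} (hπ : ∀ x, 0 < π x) (hsum : ∑ x, π x = 1) (hP : P ∈ Matrix.rowStochastic ℝ Ω)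
    (hrev : ∀ x y, π x * P x y = π y * P y x) {γ : ℝ}
    (hgap : ∀ f : Ω → ℝ, ∑ x, π x * f x = 0 →
      ∑ x, π x * (P.mulVec f) x ^ 2 ≤ (1 - γ) * ∑ x, π x * f x ^ 2)
    (hγ : γ ≤ 1) (t : ℕ) (x : Ω) :
    (∑ y, |(P ^ t) x y - π y|) ^ 2 ≤ Real.exp (-(γ * t)) / π x := by
  -- The density of the point mass at `x` relative to `π`, centered. By reversibility `P ^ t`
  -- applied to `f` is the centered density of row `x` of `P ^ t`; see `hentry`.
  set f : Ω → ℝ := fun y => (if y = x then 1 / π x else 0) - 1 with hf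
  have hPt : P ^ t ∈ Matrix.rowStochastic ℝ Ω := pow_mem hP t
  have hf0 : ∑ y, π y * f y = 0 := by
    simp [hf, mul_sub, Finset.sum_sub_distrib, hsum, (hπ x).ne']
  have hf2 : ∑ y, π y * f y ^ 2 ≤ 1 / π x := by
    have : ∀ y, π y * f y ^ 2 = (if y = x then 1 / π x else 0) - 2 * (π y * f y) - π y := by
      intro y
      simp only [hf]
      split_ifs with h
      · subst h
        have := (hπ y).ne'
        field_simp
        ring
      · ring
    simp only [this, Finset.sum_sub_distrib, ← Finset.mul_sum, hf0, hsum]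
    simp
  have hmean : ∀ s : ℕ, ∑ y, π y * ((P ^ s).mulVec f) y = 0 := by
    intro s
    have h := sum_weight_mul_mulVec_comm (detailedBalance_pow hrev s) 1 f
    rw [Matrix.one_vecMul_of_mem_rowStochastic (pow_mem hP s)] at h
    simpa [hf0] using h
  have hdecay : ∀ s : ℕ, ∑ y, π y * ((P ^ s).mulVec f) y ^ 2 ≤ (1 - γ) ^ s * (1 / π x) := by
    intro s
    induction s with
    | zero => simpa using hf2
    | succ s ih =>
      rw [pow_succ', ← Matrix.mulVec_mulVec, pow_succ', mul_assoc]
      exact (hgap _ (hmean s)).trans (mul_le_mul_of_nonneg_left ih (by linarith))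
  have hentry : ∀ y, (P ^ t) x y - π y = π y * ((P ^ t).mulVec f) y := by
    intro y
    have h1 : ((P ^ t).mulVec f) y = (P ^ t) y x / π x - 1 := by
      simp [Matrix.mulVec, dotProduct, hf, mul_sub, Finset.sum_sub_distrib,
        Matrix.sum_row_of_mem_rowStochastic hPt, div_eq_mul_inv]
    rw [h1, mul_sub, mul_one, ← mul_div_assoc, ← detailedBalance_pow hrev t x y,
      mul_div_cancel_left₀ _ (hπ x).ne']
  calc (∑ y, |(P ^ t) x y - π y|) ^ 2
      = (∑ y, π y * |((P ^ t).mulVec f) y|) ^ 2 := by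
        simp only [hentry, abs_mul, abs_of_pos (hπ _)]
    _ ≤ (∑ y, π y) * ∑ y, π y * ((P ^ t).mulVec f) y ^ 2 := by
        refine Finset.sum_sq_le_sum_mul_sum_of_sq_le_mul _ (fun y _ => (hπ y).le)
          (fun y _ => mul_nonneg (hπ y).le (sq_nonneg _)) fun y _ => ?_
        rw [mul_pow, sq_abs]
        exact le_of_eq (by ring)
    _ ≤ (1 - γ) ^ t * (1 / π x) := by rw [hsum, one_mul]; exact hdecay t
    _ ≤ Real.exp (-γ) ^ t * (1 / π x) := by
        have := hπ x
        have : 1 - γ ≤ Real.exp (-γ) := by linarith [Real.add_one_le_exp (-γ)]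
        gcongr
    _ = _ := by rw [← Real.exp_nat_mul, mul_one_div]; congr 2; ring

/-- Exponential convergence bounds the mixing times. -/
theorem exists_isMixingTime_le {Ω : Type*} [Fintype Ω] [Nonempty Ω] [DecidableEq Ω]
    {P : Matrix Ω Ω ℝ} {π : Ω → ℝ} {γ p : ℝ} (hγ : 0 < γ) (hp : 0 < p)
    (hπ : ∀ x, p ≤ π x)
    (hconv : ∀ (t : ℕ) x, (∑ y, |(P ^ t) x y - π y|) ^ 2 ≤ Real.exp (-(γ * t)) / π x)
    {ε : ℝ} (hε : 0 < ε) :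
    ∃ τ : ℕ, IsMixingTime P π ε τ ∧
      (τ : ℝ) ≤ γ⁻¹ * (max 0 (Real.log p⁻¹) + 2 * Real.posLog (1 / ε)) + 1 := by
  -- Chosen so that `exp (-b) ≤ p * ε ^ 2`. The maximum is there because `p ≤ 1` is not assumed.
  set b : ℝ := max 0 (Real.log p⁻¹) + 2 * Real.posLog (1 / ε) with hb
  have hb0 : 0 ≤ b := add_nonneg (le_max_left _ _) (mul_nonneg zero_le_two Real.posLog_nonneg)
  set t : ℕ := ⌈γ⁻¹ * b⌉₊ with ht
  have htb : b ≤ γ * t := by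
    have := Nat.le_ceil (γ⁻¹ * b)
    calc b = γ * (γ⁻¹ * b) := by field_simp
      _ ≤ γ * t := by gcongr
  have hmem : tvDistance P π t ≤ ε := by
    have h : ∀ x, ∑ y, |(P ^ t) x y - π y| ≤ ε := by
      intro x
      refine abs_le_of_sq_le_sq' ?_ hε.le |>.2
      refine (hconv t x).trans ?_
      have h1 : Real.exp (-(γ * t)) ≤ p * ε ^ 2 := by
        rw [← Real.exp_log (show 0 < p * ε ^ 2 by positivity), Real.exp_le_exp,
          Real.log_mul hp.ne' (by positivity), Real.log_pow]
        have h2 : -Real.log p ≤ max 0 (Real.log p⁻¹) := by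
          rw [Real.log_inv]; exact le_max_right _ _
        have h3 : -Real.log ε ≤ Real.posLog (1 / ε) := by
          rw [one_div, Real.posLog_apply, Real.log_inv]; exact le_max_right _ _
        push_cast
        linarith
      rw [div_le_iff₀ (hp.trans_le (hπ x))]
      calc _ ≤ p * ε ^ 2 := h1
        _ ≤ ε ^ 2 * π x := by
          rw [mul_comm]
          exact mul_le_mul_of_nonneg_left (hπ x) (sq_nonneg _)
    have := ciSup_le h
    rw [tvDistance]
    linarith
  have hne : ∃ t : ℕ, tvDistance P π t ≤ ε := ⟨t, hmem⟩
  classical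
  refine ⟨Nat.find hne, ⟨Nat.find_spec hne, fun s hs => Nat.find_min' hne hs⟩, ?_⟩
  calc (Nat.find hne : ℝ) ≤ t := by exact_mod_cast Nat.find_min' hne hmem
    _ ≤ γ⁻¹ * b + 1 := (Nat.ceil_lt_add_one (by positivity)).le

/-! ### Poincaré inequality for uniform injections -/

/-- If exchanging two values changes `f` by at most `K` in the sum of squares, then permutations of
the values with at most `k` moved points change it by at most `k ^ 2 * K`. -/
theorem sum_sub_sq_le_of_card_support_le {m n : ℕ} {f : PerfectMatching m n → ℝ} {K : ℝ}
    (hK0 : 0 ≤ K) (hK : ∀ a b : Fin n, ∑ M : PerfectMatching m n,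
      (f (M.trans (Equiv.swap a b).toEmbedding) - f M) ^ 2 ≤ K) (k : ℕ) (g : Equiv.Perm (Fin n))
    (hg : g.support.card ≤ k) :
    ∑ M : PerfectMatching m n, (f (M.trans g.toEmbedding) - f M) ^ 2 ≤ k ^ 2 * K := by
  have hone : ∀ M : PerfectMatching m n,
      M.trans (Equiv.toEmbedding (1 : Equiv.Perm (Fin n))) = M := fun M => rfl
  induction k generalizing g with
  | zero =>
    obtain rfl : g = 1 := by simpa using hg
    simp [hone]
  | succ k ih =>
    by_cases hg1 : g = 1
    · subst hg1
      simp only [hone, sub_self]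
      simp only [ne_eq, OfNat.ofNat_ne_zero, not_false_eq_true, zero_pow, Finset.sum_const_zero]
      positivity
    obtain ⟨x, hx⟩ : ∃ x, g x ≠ x := by
      by_contra! h
      exact hg1 (Equiv.ext h)
    set τ := Equiv.swap x (g x) with hτ
    set g' : Equiv.Perm (Fin n) := τ * g with hg'
    -- The transposition `τ` makes `x` a fixed point and moves no new points.
    have hcard : g'.support.card ≤ k := by
      have := Equiv.Perm.card_support_swap_mul hx
      rw [← hτ, ← hg'] at this
      omega
    have hgg : ∀ M : PerfectMatching m n,
        M.trans g.toEmbedding = (M.trans g'.toEmbedding).trans τ.toEmbedding := by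
      intro M
      ext i
      simp [hg', hτ]
    set a : PerfectMatching m n → ℝ := fun M =>
      f ((M.trans g'.toEmbedding).trans τ.toEmbedding) - f (M.trans g'.toEmbedding) with ha
    set b : PerfectMatching m n → ℝ := fun M => f (M.trans g'.toEmbedding) - f M with hb
    -- Composition with `g'` permutes the matchings, so the sum can be reindexed to involve only
    -- `τ`.
    have hA : ∑ M, a M ^ 2 ≤ K := by
      refine le_of_eq_of_le ?_ (hK x (g x))
      exact Equiv.sum_comp (Equiv.embeddingCongr (Equiv.refl (Fin m)) g')
        fun M => (f (M.trans τ.toEmbedding) - f M) ^ 2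
    have hB : ∑ M, b M ^ 2 ≤ k ^ 2 * K := ih g' hcard
    -- Cauchy–Schwarz for the cross term; this is the triangle inequality in `ℓ²` and yields `(k +
    -- 1) ^ 2`.
    have hAB : ∑ M, a M * b M ≤ k * K := by
      refine abs_le_of_sq_le_sq' ?_ (by positivity) |>.2
      calc (∑ M, a M * b M) ^ 2 ≤ (∑ M, a M ^ 2) * ∑ M, b M ^ 2 :=
            Finset.sum_mul_sq_le_sq_mul_sq _ _ _
        _ ≤ K * (k ^ 2 * K) := by
            gcongr
        _ = _ := by ring
    calc ∑ M : PerfectMatching m n, (f (M.trans g.toEmbedding) - f M) ^ 2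
        = ∑ M, (a M ^ 2 + 2 * (a M * b M) + b M ^ 2) := by
          refine Finset.sum_congr rfl fun M _ => ?_
          rw [hgg]
          ring
      _ = ∑ M, a M ^ 2 + 2 * ∑ M, a M * b M + ∑ M, b M ^ 2 := by
          rw [Finset.sum_add_distrib, Finset.sum_add_distrib, Finset.mul_sum]
      _ ≤ K + 2 * (k * K) + k ^ 2 * K := by gcongr
      _ = _ := by push_cast; ring

/-- Any two injections into a finite type differ by a permutation of the values. -/
theorem exists_perm_trans_eq {m n : ℕ} (M M' : PerfectMatching m n) :
    ∃ g : Equiv.Perm (Fin n), M.trans g.toEmbedding = M' := by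
  classical
  let e : {x // x ∈ Set.range M} ≃ {x // x ∈ Set.range M'} :=
    (Equiv.ofInjective M M.injective).symm.trans (Equiv.ofInjective M' M'.injective)
  refine ⟨e.extendSubtype, Function.Embedding.ext fun i => ?_⟩
  have h := e.extendSubtype_apply_of_mem (M i) ⟨i, rfl⟩
  have h2 : (Equiv.ofInjective M M.injective).symm ⟨M i, ⟨i, rfl⟩⟩ = i :=
    (Equiv.symm_apply_eq _).2 rfl
  simpa [e, h2] using h

/-- A Poincaré inequality for the uniform distribution on injections. -/
theorem exists_sum_sub_const_sq_le {m n : ℕ} {f : PerfectMatching m n → ℝ} {K : ℝ}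
    (hK0 : 0 ≤ K) (hK : ∀ a b : Fin n, ∑ M : PerfectMatching m n,
      (f (M.trans (Equiv.swap a b).toEmbedding) - f M) ^ 2 ≤ K) :
    ∃ c : ℝ, ∑ M, (f M - c) ^ 2 ≤ n ^ 2 * K := by
  rcases isEmpty_or_nonempty (PerfectMatching m n) with _ | ⟨⟨M₀⟩⟩
  · exact ⟨0, by simpa using by positivity⟩
  set N : ℝ := (Fintype.card (Equiv.Perm (Fin n)) : ℝ) with hN
  have hN0 : 0 < N := by
    rw [hN]
    exact_mod_cast Fintype.card_pos
  set c : ℝ := (∑ g : Equiv.Perm (Fin n), f (M₀.trans g.toEmbedding)) / N with hc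
  -- The average does not depend on the base matching, as permutations act transitively on
  -- injections.
  have hconst : ∀ M : PerfectMatching m n,
      ∑ g : Equiv.Perm (Fin n), f (M.trans g.toEmbedding) = N * c := by
    intro M
    rw [hc, mul_div_cancel₀ _ hN0.ne']
    obtain ⟨h, rfl⟩ := exists_perm_trans_eq M₀ M
    exact Equiv.sum_comp (Equiv.mulRight h) fun g => f (M₀.trans (Equiv.toEmbedding g))
  refine ⟨c, ?_⟩
  have hM : ∀ M, N * (f M - c) ^ 2 ≤
      ∑ g : Equiv.Perm (Fin n), (f (M.trans g.toEmbedding) - f M) ^ 2 := by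
    intro M
    have h1 : ∑ g : Equiv.Perm (Fin n), (f (M.trans g.toEmbedding) - f M) = N * (c - f M) := by
      simp [Finset.sum_sub_distrib, hconst, ← hN, mul_sub]
    have h2 := sq_sum_le_card_mul_sum_sq (s := Finset.univ)
      (f := fun g : Equiv.Perm (Fin n) => f (M.trans g.toEmbedding) - f M)
    rw [h1, Finset.card_univ, ← hN] at h2
    refine le_of_mul_le_mul_left ?_ hN0
    calc N * (N * (f M - c) ^ 2) = (N * (c - f M)) ^ 2 := by ring
      _ ≤ _ := h2
  refine le_of_mul_le_mul_left ?_ hN0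
  calc N * ∑ M, (f M - c) ^ 2
      ≤ ∑ M, ∑ g : Equiv.Perm (Fin n), (f (M.trans g.toEmbedding) - f M) ^ 2 := by
        rw [Finset.mul_sum]
        exact Finset.sum_le_sum fun M _ => hM M
    _ = ∑ g : Equiv.Perm (Fin n), ∑ M : PerfectMatching m n,
          (f (M.trans g.toEmbedding) - f M) ^ 2 := Finset.sum_comm
    _ ≤ ∑ _g : Equiv.Perm (Fin n), n ^ 2 * K :=
        Finset.sum_le_sum fun g _ => sum_sub_sq_le_of_card_support_le hK0 hK n g
          (by simpa using Finset.card_le_univ g.support)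
    _ = N * (n ^ 2 * K) := by rw [Finset.sum_const, nsmul_eq_mul, Finset.card_univ]

/-! ### Symmetry of proposals -/

theorem proposal_apply_self {m n : ℕ} (M : PerfectMatching m n) (y : Fin m) (z : Fin n) :
    proposal M y z y = z := by
  simp [proposal]

theorem proposal_proposal {m n : ℕ} (M : PerfectMatching m n) (y : Fin m) (z : Fin n) :
    proposal (proposal M y z) y (M y) = M := by
  ext i
  simp [proposal, Equiv.swap_comm z (M y)]

theorem proposal_apply_partner {m n : ℕ} (M : PerfectMatching m n) (y : Fin m) :
    proposal M y (M y) = M := by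
  ext i
  simp [proposal]

theorem eq_proposal_comm {m n : ℕ} (M M' : PerfectMatching m n) (y : Fin m) :
    M' = proposal M y (M' y) ↔ M = proposal M' y (M y) := by
  constructor
  · intro h
    conv_rhs => rw [h]
    exact (proposal_proposal M y (M' y)).symm
  · intro h
    conv_rhs => rw [h]
    exact (proposal_proposal M' y (M y)).symm

theorem IsAdjacentMatching.symm {m n : ℕ} {M M' : PerfectMatching m n}
    (h : IsAdjacentMatching M M') : IsAdjacentMatching M' M := by
  obtain ⟨hne, y, z, rfl⟩ := h
  exact ⟨hne.symm, y, M y, (proposal_proposal M y z).symm⟩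

/-- If `a` or `b` is the partner of some node `i`, the transposition is a proposal at `i`; if both
are unmatched, it changes nothing. -/
theorem isAdjacentMatching_trans_swap {m n : ℕ} {M : PerfectMatching m n} {a b : Fin n}
    (h : M.trans (Equiv.swap a b).toEmbedding ≠ M) :
    IsAdjacentMatching M (M.trans (Equiv.swap a b).toEmbedding) := by
  refine ⟨h.symm, ?_⟩
  by_contra! hnot
  refine h (Function.Embedding.ext fun i => ?_)
  have ha : M i ≠ a := by
    rintro rfl
    exact hnot i b rfl
  have hb : M i ≠ b := by
    rintro rfl
    exact hnot i a (by rw [proposal, Equiv.swap_comm])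
  simpa using Equiv.swap_apply_of_ne_of_ne ha hb

/-! ### Gibbs weights and the two Metropolis chains -/

section Gibbs
variable {m n : ℕ} (β : ℝ) (U : PerfectMatching m n → ℝ)

theorem acceptProb_nonneg (M M' : PerfectMatching m n) : 0 ≤ acceptProb β U M M' :=
  le_min zero_le_one (Real.exp_pos _).le

theorem acceptProb_le_one (M M' : PerfectMatching m n) : acceptProb β U M M' ≤ 1 :=
  min_le_left _ _

theorem acceptProb_self (M : PerfectMatching m n) : acceptProb β U M M = 1 := by
  simp [acceptProb]

theorem gibbs_pos (M : PerfectMatching m n) : 0 < gibbs β U M :=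
  div_pos (Real.exp_pos _) (Finset.sum_pos (fun _ _ => Real.exp_pos _) ⟨M, Finset.mem_univ _⟩)

theorem sum_gibbs [Nonempty (PerfectMatching m n)] : ∑ M, gibbs β U M = 1 := by
  simp only [gibbs]
  rw [← Finset.sum_div, div_self]
  exact (Finset.sum_pos (fun _ _ => Real.exp_pos _) Finset.univ_nonempty).ne'

theorem gibbs_mul_exp (M M' : PerfectMatching m n) :
    gibbs β U M * Real.exp (β * (U M' - U M)) = gibbs β U M' := by
  rw [gibbs, gibbs, div_mul_eq_mul_div, ← Real.exp_add]
  congr 2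
  ring

/-- The acceptance rule balances the Gibbs weights. -/
theorem gibbs_mul_acceptProb (M M' : PerfectMatching m n) :
    gibbs β U M * acceptProb β U M M' = min (gibbs β U M) (gibbs β U M') := by
  rw [acceptProb, mul_min_of_nonneg _ _ (gibbs_pos β U M).le, mul_one, gibbs_mul_exp]

theorem gibbs_mul_acceptProb_comm (M M' : PerfectMatching m n) :
    gibbs β U M * acceptProb β U M M' = gibbs β U M' * acceptProb β U M' M := by
  rw [gibbs_mul_acceptProb, gibbs_mul_acceptProb, min_comm]

/-- The properties of the chain and its lazy version that enforce rapid mixing. -/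
structure IsMetropolisChain (P : Matrix (PerfectMatching m n) (PerfectMatching m n) ℝ) :
    Prop where
  stochastic : P ∈ Matrix.rowStochastic ℝ (PerfectMatching m n)
  balance : ∀ M M', gibbs β U M * P M M' = gibbs β U M' * P M' M
  holding : ∀ M, 1 / (2 * (n : ℝ)) ≤ P M M
  move : ∀ M M', IsAdjacentMatching M M' → 1 / (2 * (m : ℝ) * n) * acceptProb β U M M' ≤ P M M'

/-- A proposal at `y` gives `y` the partner `z`, so only `z = M' y` can lead to `M'`. Several `y`
may contribute: an exchange of partners is proposed from both of its left nodes. -/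
theorem transitionMatrix_of_ne {M M' : PerfectMatching m n} (h : M' ≠ M) :
    transitionMatrix β U M M' = acceptProb β U M M' * ∑ y : Fin m,
      if M' = proposal M y (M' y) then 1 / ((m : ℝ) * n) else 0 := by
  rw [transitionMatrix, Finset.mul_sum]
  refine Finset.sum_congr rfl fun y _ => ?_
  rw [Finset.sum_eq_single (M' y)]
  · split_ifs with h1
    · rw [← h1]
      ring
    · simp
  · intro z _ hz
    have : M' ≠ proposal M y z := by
      intro h2
      exact hz (by rw [h2, proposal_apply_self])
    simp [this, h]
  · simp

theorem transitionMatrix_summand_nonneg (M M' : PerfectMatching m n) (y : Fin m) (z : Fin n) :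
    0 ≤ 1 / ((m : ℝ) * n) *
      ((if M' = proposal M y z then acceptProb β U M (proposal M y z) else 0) +
        (if M' = M then 1 - acceptProb β U M (proposal M y z) else 0)) := by
  have h1 := acceptProb_nonneg β U M (proposal M y z)
  have h2 := acceptProb_le_one β U M (proposal M y z)
  refine mul_nonneg (by positivity) (add_nonneg ?_ ?_)
  · split_ifs <;> simp [h1]
  · split_ifs <;> simp [h2]

theorem isMetropolisChain_transitionMatrix (hm : 0 < m) (hmn : m ≤ n) :
    IsMetropolisChain β U (transitionMatrix β U) where
  stochastic := by
    have hm' : (m : ℝ) ≠ 0 := by exact_mod_cast hm.ne'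
    have hn' : (n : ℝ) ≠ 0 := by exact_mod_cast (hm.trans_le hmn).ne'
    refine Matrix.mem_rowStochastic_iff_sum.2 ⟨fun M M' => ?_, fun M => ?_⟩
    · exact Finset.sum_nonneg fun y _ => Finset.sum_nonneg fun z _ =>
        transitionMatrix_summand_nonneg β U M M' y z
    · simp only [transitionMatrix]
      rw [Finset.sum_comm]
      have h : ∀ y : Fin m, ∑ M', ∑ z : Fin n, 1 / ((m : ℝ) * n) *
          ((if M' = proposal M y z then acceptProb β U M (proposal M y z) else 0) +
            (if M' = M then 1 - acceptProb β U M (proposal M y z) else 0)) = 1 / m := by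
        intro y
        rw [Finset.sum_comm]
        simp only [← Finset.mul_sum, Finset.sum_add_distrib, Finset.sum_ite_eq', Finset.mem_univ,
          if_true]
        rw [← Finset.sum_add_distrib]
        simp
        field_simp
      simp only [h]
      simp
      field_simp
  balance M M' := by
    by_cases h : M' = M
    · rw [h]
    rw [transitionMatrix_of_ne β U h, transitionMatrix_of_ne β U (Ne.symm h), ← mul_assoc,
      ← mul_assoc, gibbs_mul_acceptProb_comm]
    simp only [eq_proposal_comm M M']
  holding M := by
    have hm' : (0 : ℝ) < m := by exact_mod_cast hm
    have hn' : (0 : ℝ) < n := by exact_mod_cast hm.trans_le hmn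
    -- The selections `z = M y`, of total probability `1 / n`, leave `M` unchanged.
    calc 1 / (2 * (n : ℝ)) ≤ 1 / n := by gcongr; linarith
      _ = ∑ y : Fin m, 1 / ((m : ℝ) * n) := by
          simp
          field_simp
      _ ≤ transitionMatrix β U M M := by
          refine Finset.sum_le_sum fun y _ => ?_
          refine le_of_eq_of_le ?_ (Finset.single_le_sum (fun z _ =>
            transitionMatrix_summand_nonneg β U M M y z) (Finset.mem_univ (M y)))
          simp [proposal_apply_partner, acceptProb_self]
  move M M' := by
    rintro ⟨hne, y, z, h⟩
    have hz : M' y = z := by rw [h, proposal_apply_self]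
    rw [transitionMatrix_of_ne β U hne.symm, mul_comm]
    refine mul_le_mul_of_nonneg_left ?_ (acceptProb_nonneg _ _ _ _)
    calc 1 / (2 * (m : ℝ) * n) = 1 / ((m : ℝ) * n) / 2 := by
          rw [div_div]
          congr 1
          ring
      _ ≤ 1 / ((m : ℝ) * n) := half_le_self (by positivity)
      _ = if M' = proposal M y (M' y) then 1 / ((m : ℝ) * n) else 0 := by
          rw [hz, if_pos h]
      _ ≤ _ := Finset.single_le_sum (f := fun y : Fin m =>
          if M' = proposal M y (M' y) then 1 / ((m : ℝ) * n) else 0)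
          (fun y _ => by positivity) (Finset.mem_univ y)

theorem lazyMoveProb_nonneg (M M' : PerfectMatching m n) : 0 ≤ lazyMoveProb β U M M' := by
  have := acceptProb_nonneg β U M M'
  unfold lazyMoveProb
  positivity

theorem lazyMoveProb_self (M : PerfectMatching m n) : lazyMoveProb β U M M = 0 :=
  if_neg fun h => h.1 rfl

/-- A union bound: every adjacent matching comes from one of the `m * n` pairs, and each pair
accounts for at most `1 / (2 * m * n)`. -/
theorem sum_lazyMoveProb_le (hm : 0 < m) (hmn : m ≤ n) (M : PerfectMatching m n) :
    ∑ M', lazyMoveProb β U M M' ≤ 1 / 2 := by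
  have hm' : (0 : ℝ) < m := by exact_mod_cast hm
  have hn' : (0 : ℝ) < n := by exact_mod_cast hm.trans_le hmn
  calc ∑ M', lazyMoveProb β U M M'
      ≤ ∑ M', ∑ q : Fin m × Fin n,
          if M' = proposal M q.1 q.2 then 1 / (2 * (m : ℝ) * n) else 0 := by
        refine Finset.sum_le_sum fun M' _ => ?_
        have hnn : ∀ q : Fin m × Fin n,
            0 ≤ if M' = proposal M q.1 q.2 then 1 / (2 * (m : ℝ) * n) else 0 :=
          fun q => by positivity
        unfold lazyMoveProb
        split_ifs with h
        · obtain ⟨-, y, z, h⟩ := h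
          calc 1 / (2 * (m : ℝ) * n) * acceptProb β U M M' ≤ 1 / (2 * (m : ℝ) * n) :=
                mul_le_of_le_one_right (by positivity) (acceptProb_le_one _ _ _ _)
            _ = if M' = proposal M (y, z).1 (y, z).2 then 1 / (2 * (m : ℝ) * n) else 0 := by
                rw [if_pos h]
            _ ≤ _ := Finset.single_le_sum (fun q _ => hnn q) (Finset.mem_univ (y, z))
        · exact Finset.sum_nonneg fun q _ => hnn q
    _ = 1 / 2 := by
        rw [Finset.sum_comm]
        simp
        field_simp

theorem isMetropolisChain_lazyTransitionMatrix (hm : 0 < m) (hmn : m ≤ n) :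
    IsMetropolisChain β U (lazyTransitionMatrix β U) where
  stochastic := by
    refine Matrix.mem_rowStochastic_iff_sum.2 ⟨fun M M' => ?_, fun M => ?_⟩
    · unfold lazyTransitionMatrix
      split_ifs
      · linarith [sum_lazyMoveProb_le β U hm hmn M]
      · exact lazyMoveProb_nonneg β U M M'
    · have h : ∀ M', lazyTransitionMatrix β U M M' =
          (if M' = M then 1 - ∑ M'', lazyMoveProb β U M M'' else 0) + lazyMoveProb β U M M' := by
        intro M'
        unfold lazyTransitionMatrix
        split_ifs with h
        · rw [h, lazyMoveProb_self, add_zero]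
        · rw [zero_add]
      simp [h, Finset.sum_add_distrib]
  balance M M' := by
    by_cases h : M' = M
    · rw [h]
    simp only [lazyTransitionMatrix, h, Ne.symm h, if_false, lazyMoveProb]
    by_cases hadj : IsAdjacentMatching M M'
    · rw [if_pos hadj, if_pos hadj.symm]
      linear_combination 1 / (2 * (m : ℝ) * n) * gibbs_mul_acceptProb_comm β U M M'
    · rw [if_neg hadj, if_neg fun h => hadj h.symm, mul_zero, mul_zero]
  holding M := by
    have hn' : (1 : ℝ) ≤ n := by exact_mod_cast hm.trans_le hmn
    have h1 := sum_lazyMoveProb_le β U hm hmn M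
    have h2 : 1 / (2 * (n : ℝ)) ≤ 1 / 2 := by gcongr; linarith
    rw [lazyTransitionMatrix, if_pos rfl]
    linarith
  move M M' h := by
    rw [lazyTransitionMatrix, if_neg h.1.symm, lazyMoveProb, if_pos h]

end Gibbs

/-! ### Spectral gap and mixing time in terms of the utility range -/

section Mixing
variable {m n : ℕ} {β : ℝ} {U : PerfectMatching m n → ℝ}
  {P : Matrix (PerfectMatching m n) (PerfectMatching m n) ℝ}

theorem IsMetropolisChain.isStationaryDistribution [Nonempty (PerfectMatching m n)]
    (hP : IsMetropolisChain β U P) : IsStationaryDistribution P (gibbs β U) := by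
  refine ⟨fun M => (gibbs_pos β U M).le, sum_gibbs β U, funext fun M => ?_⟩
  simp only [Matrix.vecMul, dotProduct, hP.balance _ M]
  rw [← Finset.mul_sum, Matrix.sum_row_of_mem_rowStochastic hP.stochastic, mul_one]

/-- A Poincaré inequality for the Gibbs distribution, whose weights lie between `p` and `r * p`. -/
theorem IsMetropolisChain.sum_gibbs_mul_sq_le (hP : IsMetropolisChain β U P) (hm : 0 < m)
    (hmn : m ≤ n) {p r : ℝ} (hp : 0 < p) (hlow : ∀ M, p ≤ gibbs β U M)
    (hup : ∀ M, gibbs β U M ≤ r * p) (hr : 0 ≤ r) [Nonempty (PerfectMatching m n)]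
    {f : PerfectMatching m n → ℝ} (hf : ∑ M, gibbs β U M * f M = 0) :
    ∑ M, gibbs β U M * f M ^ 2 ≤ 2 * r * n ^ 4 *
      ∑ M, ∑ M', gibbs β U M * P M M' * (f M - f M') ^ 2 := by
  have hm' : (0 : ℝ) < m := by exact_mod_cast hm
  have hn' : (0 : ℝ) < n := by exact_mod_cast hm.trans_le hmn
  have hmn' : (m : ℝ) ≤ n := by exact_mod_cast hmn
  set F := ∑ M, ∑ M', gibbs β U M * P M M' * (f M - f M') ^ 2 with hF
  have hterm : ∀ M M', 0 ≤ gibbs β U M * P M M' * (f M - f M') ^ 2 := fun M M' =>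
    mul_nonneg (mul_nonneg (gibbs_pos β U M).le (hP.stochastic.1 M M')) (sq_nonneg _)
  have hF0 : 0 ≤ F := Finset.sum_nonneg fun M _ => Finset.sum_nonneg fun M' _ => hterm M M'
  have hK : ∀ a b : Fin n, ∑ M : PerfectMatching m n,
      (f (M.trans (Equiv.swap a b).toEmbedding) - f M) ^ 2 ≤ 2 * m * n / p * F := by
    intro a b
    rw [hF, Finset.mul_sum]
    refine Finset.sum_le_sum fun M _ => ?_
    set M' := M.trans (Equiv.swap a b).toEmbedding with hM'
    by_cases h : M' = M
    · rw [h, sub_self, zero_pow two_ne_zero]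
      exact mul_nonneg (by positivity) (Finset.sum_nonneg fun M' _ => hterm M M')
    have hadj : IsAdjacentMatching M M' := isAdjacentMatching_trans_swap h
    -- The stationary flow along a move is at least the smaller of its two Gibbs weights over `2 * m
    -- * n`.
    have hflow : p / (2 * m * n) ≤ gibbs β U M * P M M' :=
      calc p / (2 * m * n) = 1 / (2 * (m : ℝ) * n) * p := by ring
        _ ≤ 1 / (2 * (m : ℝ) * n) * (gibbs β U M * acceptProb β U M M') := by
            rw [gibbs_mul_acceptProb]
            have := le_min (hlow M) (hlow M')
            gcongr
        _ = gibbs β U M * (1 / (2 * (m : ℝ) * n) * acceptProb β U M M') := by ring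
        _ ≤ _ := mul_le_mul_of_nonneg_left (hP.move M M' hadj) (gibbs_pos β U M).le
    calc (f M' - f M) ^ 2 = 2 * m * n / p * (p / (2 * m * n) * (f M - f M') ^ 2) := by
          field_simp
          ring
      _ ≤ 2 * m * n / p * (gibbs β U M * P M M' * (f M - f M') ^ 2) := by gcongr
      _ ≤ _ := by
          gcongr
          exact Finset.single_le_sum (f := fun M' => gibbs β U M * P M M' * (f M - f M') ^ 2)
            (fun M' _ => hterm M M') (Finset.mem_univ M')
  obtain ⟨c, hc⟩ := exists_sum_sub_const_sq_le (by positivity) hK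
  -- The Gibbs mean of `f` is `0`, and the mean minimizes the expected squared deviation, so the
  -- constant `c` of the uniform inequality can be used.
  have hcenter : ∑ M, gibbs β U M * f M ^ 2 ≤ ∑ M, gibbs β U M * (f M - c) ^ 2 := by
    have : ∀ M, gibbs β U M * (f M - c) ^ 2 =
        gibbs β U M * f M ^ 2 - 2 * c * (gibbs β U M * f M) + c ^ 2 * gibbs β U M :=
      fun M => by ring
    simp only [this, Finset.sum_add_distrib, Finset.sum_sub_distrib, ← Finset.mul_sum, hf,
      sum_gibbs]
    nlinarith [sq_nonneg c]
  calc ∑ M, gibbs β U M * f M ^ 2 ≤ ∑ M, gibbs β U M * (f M - c) ^ 2 := hcenter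
    _ ≤ ∑ M, r * p * (f M - c) ^ 2 :=
        Finset.sum_le_sum fun M _ => mul_le_mul_of_nonneg_right (hup M) (sq_nonneg _)
    _ ≤ r * p * (n ^ 2 * (2 * m * n / p * F)) := by
        rw [← Finset.mul_sum]
        gcongr
    _ = 2 * r * (n ^ 3 * m) * F := by
        field_simp
    _ ≤ 2 * r * (n ^ 3 * n) * F := by gcongr
    _ = _ := by ring

/-- An explicit bound for the mixing time in terms of the range `R` of the utility. -/
theorem IsMetropolisChain.exists_isMixingTime_le (hP : IsMetropolisChain β U P) (hβ : 0 ≤ β)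
    (hm : 0 < m) (hmn : m ≤ n) {R : ℝ} (hR0 : 0 ≤ R) (hR : ∀ M M', U M - U M' ≤ R)
    {ε : ℝ} (hε : 0 < ε) :
    ∃ τ : ℕ, IsMixingTime P (gibbs β U) ε τ ∧
      (τ : ℝ) ≤ 4 * Real.exp (β * R) * n ^ 5 *
        ((n ^ 2 + β * R) + 2 * Real.posLog (1 / ε)) + 1 := by
  have hn' : (1 : ℝ) ≤ n := by exact_mod_cast hm.trans_le hmn
  have hne : Nonempty (PerfectMatching m n) := ⟨Fin.castLEEmb hmn⟩
  set r := Real.exp (β * R) with hr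
  have hr1 : 1 ≤ r := Real.one_le_exp (by positivity)
  obtain ⟨M₀, hM₀⟩ := Finite.exists_min (gibbs β U)
  set p := gibbs β U M₀ with hp
  have hp0 : 0 < p := gibbs_pos β U M₀
  have hup : ∀ M, gibbs β U M ≤ r * p := by
    intro M
    rw [← gibbs_mul_exp β U M₀ M, mul_comm]
    exact mul_le_mul_of_nonneg_right
      (Real.exp_le_exp.2 (mul_le_mul_of_nonneg_left (hR M M₀) hβ)) hp0.le
  -- The gap is the holding bound `1 / (2 * n)` times the inverse Poincaré constant `1 / (2 * r * n
  -- ^ 4)`.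
  have hgap : ∀ f : PerfectMatching m n → ℝ, ∑ M, gibbs β U M * f M = 0 →
      ∑ M, gibbs β U M * (P.mulVec f) M ^ 2 ≤
        (1 - (4 * r * n ^ 5)⁻¹) * ∑ M, gibbs β U M * f M ^ 2 := by
    intro f hf
    have h1 := hP.sum_gibbs_mul_sq_le hm hmn hp0 hM₀ hup (by positivity) hf
    have h2 := sum_weight_mul_mulVec_sq_le (fun M => (gibbs_pos β U M).le) hP.stochastic
      hP.balance hP.holding f
    refine h2.trans ?_
    rw [sub_mul, one_mul]
    refine sub_le_sub_left ?_ _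
    calc (4 * r * n ^ 5)⁻¹ * ∑ M, gibbs β U M * f M ^ 2
        ≤ (4 * r * n ^ 5)⁻¹ * (2 * r * n ^ 4 *
            ∑ M, ∑ M', gibbs β U M * P M M' * (f M - f M') ^ 2) := by gcongr
      _ = _ := by
        field_simp
        ring
  have hγ1 : (4 * r * n ^ 5)⁻¹ ≤ 1 := by
    refine inv_le_one_of_one_le₀ ?_
    have : 1 ≤ r * (n : ℝ) ^ 5 := one_le_mul_of_one_le_of_one_le hr1 (one_le_pow₀ hn')
    linarith
  obtain ⟨τ, hτ, hle⟩ := _root_.exists_isMixingTime_le (by positivity) hp0 hM₀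
    (sq_sum_abs_pow_sub_le (gibbs_pos β U) (sum_gibbs β U) hP.stochastic hP.balance hgap hγ1) hε
  refine ⟨τ, hτ, hle.trans ?_⟩
  rw [inv_inv]
  gcongr
  refine max_le (by positivity) ?_
  -- At most `n ^ n` matchings, each of weight at most `r * p`, share the total weight `1`.
  have hinv : p⁻¹ ≤ (n : ℝ) ^ n * r := by
    rw [inv_le_iff_one_le_mul₀ hp0]
    calc (1 : ℝ) = ∑ M, gibbs β U M := (sum_gibbs β U).symm
      _ ≤ ∑ _M : PerfectMatching m n, r * p := Finset.sum_le_sum fun M _ => hup M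
      _ = (Fintype.card (PerfectMatching m n) : ℝ) * (r * p) := by
          rw [Finset.sum_const, nsmul_eq_mul, Finset.card_univ]
      _ ≤ (n : ℝ) ^ n * (r * p) := by
          gcongr
          rw [Fintype.card_embedding_eq, Fintype.card_fin, Fintype.card_fin]
          calc ((n.descFactorial m : ℕ) : ℝ) ≤ ((n ^ m : ℕ) : ℝ) := by
                exact_mod_cast Nat.descFactorial_le_pow n m
            _ ≤ (n : ℝ) ^ n := by
                push_cast
                exact pow_le_pow_right₀ hn' hmn
      _ = _ := by ring
  calc Real.log p⁻¹ ≤ Real.log ((n : ℝ) ^ n * r) := Real.log_le_log (by positivity) hinv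
    _ = n * Real.log n + β * R := by
        rw [Real.log_mul (by positivity) (by positivity), Real.log_pow, hr, Real.log_exp]
    _ ≤ n ^ 2 + β * R := by
        rw [sq]
        gcongr
        exact Real.log_le_self (by positivity)

end Mixing

/-! ### Utility ranges and the main theorem -/

theorem sub_le_utilityRange {m n : ℕ} (U : PerfectMatching m n → ℝ) (M M' : PerfectMatching m n) :
    U M - U M' ≤ utilityRange U :=
  sub_le_sub (le_ciSup (Set.finite_range U).bddAbove M)
    (ciInf_le (Set.finite_range U).bddBelow M')

theorem utilityRange_le {m n : ℕ} [Nonempty (PerfectMatching m n)] {U : PerfectMatching m n → ℝ}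
    {R : ℝ} (h : ∀ M M', U M - U M' ≤ R) : utilityRange U ≤ R := by
  obtain ⟨M, hM⟩ := exists_eq_ciSup_of_finite (f := U)
  obtain ⟨M', hM'⟩ := exists_eq_ciInf_of_finite (f := U)
  rw [utilityRange, ← hM, ← hM']
  exact h M M'

/-- Metropolis chains for utilities whose ranges grow at most logarithmically mix rapidly. -/
theorem rapidlyMixing_of_isMetropolisChain {ι : Type*} {β : ℝ} (hβ : 0 ≤ β) {m n : ι → ℕ}
    (hm : ∀ i, 0 < m i) (hmn : ∀ i, m i ≤ n i) {U : ∀ i, PerfectMatching (m i) (n i) → ℝ}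
    {P : ∀ i, Matrix (PerfectMatching (m i) (n i)) (PerfectMatching (m i) (n i)) ℝ}
    (hP : ∀ i, IsMetropolisChain β (U i) (P i)) {A B : ℝ}
    (hAB : ∀ i, utilityRange (U i) ≤ A + B * Real.log (n i)) :
    RapidlyMixing n (fun i => PerfectMatching (m i) (n i)) P (fun i => gibbs β (U i)) := by
  have hne : ∀ i, Nonempty (PerfectMatching (m i) (n i)) := fun i => ⟨Fin.castLEEmb (hmn i)⟩
  refine ⟨fun i => ⟨(hP i).stochastic, (hP i).isStationaryDistribution⟩, ?_⟩
  obtain ⟨j, hj⟩ := exists_nat_ge (β * |B|)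
  set K := Real.exp (β * |A|) with hK
  have hK1 : 1 ≤ K := Real.one_le_exp (by positivity)
  -- The exponent is `j + 5 + (j + 2)`, where `exp (β * R) ≤ K * N ^ j`; the factor is `4 * 4`, plus
  -- `1` for rounding the time up.
  refine ⟨17 * K ^ 2, 2 * j + 7, fun i ε hε => ?_⟩
  have hn1 : (1 : ℝ) ≤ n i := by exact_mod_cast (hm i).trans_le (hmn i)
  have hlog : 0 ≤ Real.log (n i) := Real.log_nonneg hn1
  set R : ℝ := |A| + |B| * Real.log (n i) with hR
  have hR0 : 0 ≤ R := by positivity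
  have hUR : ∀ M M', U i M - U i M' ≤ R := fun M M' =>
    (sub_le_utilityRange (U i) M M').trans ((hAB i).trans
      (add_le_add (le_abs_self A) (mul_le_mul_of_nonneg_right (le_abs_self B) hlog)))
  obtain ⟨τ, hτ, hle⟩ := (hP i).exists_isMixingTime_le hβ (hm i) (hmn i) hR0 hUR hε
  refine ⟨τ, hτ, hle.trans ?_⟩
  set L := Real.posLog (1 / ε)
  have hL : 0 ≤ L := Real.posLog_nonneg
  set N : ℝ := (n i : ℝ)
  have hexp : Real.exp (β * R) ≤ K * N ^ j := by
    have : β * R = β * |A| + β * |B| * Real.log N := by rw [hR]; ring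
    rw [this, Real.exp_add]
    gcongr
    calc Real.exp (β * |B| * Real.log N) ≤ Real.exp (j * Real.log N) := by gcongr
      _ = N ^ j := by rw [Real.exp_nat_mul, Real.exp_log (by positivity)]
  have hβR : β * R ≤ K * N ^ j := by linarith [Real.add_one_le_exp (β * R)]
  have h1 : N ^ j ≤ N ^ (j + 2) := pow_le_pow_right₀ hn1 (by omega)
  have h2 : N ^ 2 ≤ N ^ (j + 2) := pow_le_pow_right₀ hn1 (by omega)
  have h3 : 1 ≤ N ^ (j + 2) := one_le_pow₀ hn1
  have h4 : 1 ≤ K * N ^ (j + 2) := one_le_mul_of_one_le_of_one_le hK1 h3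
  have h5 : N ^ 2 + β * R + 2 * L ≤ 4 * (K * N ^ (j + 2)) * (1 + L) := by
    have h6 : N ^ 2 ≤ K * N ^ (j + 2) := h2.trans (le_mul_of_one_le_left (by positivity) hK1)
    have h7 : β * R ≤ K * N ^ (j + 2) := hβR.trans (by gcongr)
    nlinarith
  have h8 : 1 ≤ K ^ 2 * N ^ (2 * j + 7) * (1 + L) :=
    one_le_mul_of_one_le_of_one_le
      (one_le_mul_of_one_le_of_one_le (one_le_pow₀ hK1) (one_le_pow₀ hn1)) (by linarith)
  calc 4 * Real.exp (β * R) * N ^ 5 * (N ^ 2 + β * R + 2 * L) + 1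
      ≤ 4 * (K * N ^ j) * N ^ 5 * (4 * (K * N ^ (j + 2)) * (1 + L)) +
          K ^ 2 * N ^ (2 * j + 7) * (1 + L) := by
        gcongr
    _ = 17 * K ^ 2 * N ^ (2 * j + 7) * (1 + L) := by ring

theorem matchingChainRapidlyMixing_of_utilityRange_le {ι : Type*} {β : ℝ} (hβ : 0 ≤ β)
    {m n : ι → ℕ} (hm : ∀ i, 0 < m i) (hmn : ∀ i, m i ≤ n i)
    {U : ∀ i, PerfectMatching (m i) (n i) → ℝ}
    (h : ∃ A B : ℝ, ∀ i, utilityRange (U i) ≤ A + B * Real.log (n i)) :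
    MatchingChainRapidlyMixing β m n U := by
  obtain ⟨A, B, hAB⟩ := h
  exact ⟨rapidlyMixing_of_isMetropolisChain hβ hm hmn
      (fun i => isMetropolisChain_transitionMatrix β (U i) (hm i) (hmn i)) hAB,
    rapidlyMixing_of_isMetropolisChain hβ hm hmn
      (fun i => isMetropolisChain_lazyTransitionMatrix β (U i) (hm i) (hmn i)) hAB⟩

/-- The logarithm of a utility bounded below by an inverse polynomial, with polynomial range, has
logarithmic range. -/
theorem utilityRange_log_le {m n : ℕ} (hm : 0 < m) (hmn : m ≤ n) {U : PerfectMatching m n → ℝ}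
    {s C : ℝ} {k : ℕ} (hC : 0 < C) (hrange : utilityRange U ≤ C * (n : ℝ) ^ k)
    (hlow : ∀ M, 1 / (C * (n : ℝ) ^ k) ≤ U M + s) :
    utilityRange (fun M => Real.log (U M + s)) ≤ Real.log (1 + C ^ 2) + 2 * k * Real.log n := by
  have hne : Nonempty (PerfectMatching m n) := ⟨Fin.castLEEmb hmn⟩
  have hn1 : (1 : ℝ) ≤ n := by exact_mod_cast hm.trans_le hmn
  set D : ℝ := C * (n : ℝ) ^ k with hD
  have hD0 : 0 < D := by positivity
  have hpos : ∀ M, 0 < U M + s := fun M => lt_of_lt_of_le (by positivity) (hlow M)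
  refine utilityRange_le fun M M' => ?_
  rw [← Real.log_div (hpos M).ne' (hpos M').ne']
  have hdiff : U M - U M' ≤ D := (sub_le_utilityRange U M M').trans hrange
  have h1 : 1 ≤ D * (U M' + s) := (div_le_iff₀' hD0).1 (hlow M')
  -- The numerator exceeds the denominator by at most `D`, and the denominator is at least `1 / D`,
  -- so the ratio is at most `1 + D ^ 2`.
  have h2 : (U M + s) / (U M' + s) ≤ (1 + C ^ 2) * (n : ℝ) ^ (2 * k) := by
    rw [div_le_iff₀ (hpos M')]
    have h3 : (1 : ℝ) ≤ (n : ℝ) ^ (2 * k) := one_le_pow₀ hn1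
    calc U M + s ≤ U M' + s + D * 1 := by linarith
      _ ≤ 1 * (U M' + s) + D * (D * (U M' + s)) := by rw [one_mul]; gcongr
      _ ≤ (n : ℝ) ^ (2 * k) * (U M' + s) + D * (D * (U M' + s)) := by
          have := (hpos M').le
          gcongr
      _ = _ := by rw [hD]; ring
  calc Real.log ((U M + s) / (U M' + s)) ≤ Real.log ((1 + C ^ 2) * (n : ℝ) ^ (2 * k)) :=
        Real.log_le_log (div_pos (hpos M) (hpos M')) h2
    _ = _ := by
        rw [Real.log_mul (by positivity) (by positivity), Real.log_pow]
        push_cast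
        ring

theorem mainTheorem3 {ι : Type*} (β : ℝ) (hβ : 0 ≤ β) (m n : ι → ℕ)
    (hm : ∀ i, 0 < m i) (hmn : ∀ i, m i ≤ n i)
    (U : ∀ i, PerfectMatching (m i) (n i) → ℝ) :
    -- `U_max - U_min` is bounded or grows at most logarithmically in the input size
    ((∃ A B : ℝ, ∀ i, utilityRange (U i) ≤ A + B * Real.log (n i)) →
      MatchingChainRapidlyMixing β m n U) ∧
    -- `U_max - U_min` grows at most polynomially: pass to the logarithm of the (shifted) utility
    (∀ (s : ι → ℝ) (C : ℝ) (k : ℕ), 0 < C →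
      (∀ i, utilityRange (U i) ≤ C * (n i : ℝ) ^ k) →
      (∀ i M, 1 / (C * (n i : ℝ) ^ k) ≤ U i M + s i) →
      (∀ i M, (∀ M', U i M' ≤ U i M) ↔
        ∀ M', Real.log (U i M' + s i) ≤ Real.log (U i M + s i)) ∧
      (∃ A B : ℝ, ∀ i, utilityRange (fun M => Real.log (U i M + s i)) ≤
        A + B * Real.log (n i)) ∧
      MatchingChainRapidlyMixing β m n (fun i M => Real.log (U i M + s i))) := by
  refine ⟨matchingChainRapidlyMixing_of_utilityRange_le hβ hm hmn, ?_⟩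
  intro s C k hC hrange hlow
  have hlog : ∃ A B : ℝ, ∀ i, utilityRange (fun M => Real.log (U i M + s i)) ≤
      A + B * Real.log (n i) :=
    ⟨_, _, fun i => utilityRange_log_le (hm i) (hmn i) hC (hrange i) (hlow i)⟩
  refine ⟨fun i M => forall_congr' fun M' => ?_, hlog,
    matchingChainRapidlyMixing_of_utilityRange_le hβ hm hmn hlog⟩
  have hn0 : (0 : ℝ) < n i := by exact_mod_cast (hm i).trans_le (hmn i)
  have hpos : ∀ M, 0 < U i M + s i := fun M => lt_of_lt_of_le (by positivity) (hlow i M)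
  rw [Real.log_le_log_iff (hpos M') (hpos M), add_le_add_iff_right]
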